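/- A \emph{rack} is a set $X$ with a map $s:X\to S_X$, $x\mapsto s_x$, into the permutations of $X$ such that $s_xs_y=s_{s_x(y)}s_x$ for all $x,y\in X$; a rack homomorphism $\phi:(X,s)\to(Y,t)$ is a map with $\phi s_x=t_{\phi(x)}\phi$ for all $x\in X$. A rack is \emph{medial} if $s_{s_x(z)}s_y=s_{s_x(y)}s_z$ for all $x,y,z\in X$. A \emph{GL-rack} is a rack $(X,s)$ with a rack automorphism $\mathtt{u}$ such that $\mathtt{u}s_x=s_x\mathtt{u}$ for all $x\in X$; GL-rack homomorphisms are the rack homomorphisms that commute with $\mathtt{u}$, and a GL-rack is medial if its underlying rack is. Let $\mathsf{Rack}_{\mathrm{med}}$ and $\mathsf{GLR}_{\mathrm{med}}$ be the full subcategories of medial objects in the categories of racks and of GL-racks. The \emph{tensor product} $R_1\otimes R_2$ of two racks $R_1=(X,r)$ and $R_2=(Y,t)$ is the free rack on $X\times Y$ modulo the smallest congruence such that, writing $x\otimes y$ for the generator $(x,y)$, $$s^{\pm1}_{x\otimes y_2}(x\otimes y_1)\sim x\otimes t^{\pm1}_{y_2}(y_1),\qquad s^{\pm1}_{x_2\otimes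 y}(x_1\otimes y)\sim r^{\pm1}_{x_2}(x_1)\otimes y$$ for all $x,x_1,x_2\in X$ and $y,y_1,y_2\in Y$. For GL-racks $(R_1,\mathtt{u}_1)$ and $(R_2,\mathtt{u}_2)$ one uses the free GL-rack and congruences of GL-racks, and imposes in addition $\mathtt{u}(x\otimes y)\sim\mathtt{u}_1(x)\otimes y\sim x\otimes\mathtt{u}_2(y)$. The \emph{medial tensor product} $R_1\otimes_{\mathrm{med}}R_2$ is the quotient of $R_1\otimes R_2$ by the smallest congruence such that $s_{s_x(z)}s_y(a)\sim s_{s_x(y)}s_z(a)$ for all $x,y,z,a$; the class of $x\otimes y$ is again denoted by $x\otimes y$. For a rack $R$ and a medial rack $M=(Y,t)$, the \emph{Hom rack} is the set of rack homomorphisms $R\to M$ with the medial rack structure $\tilde t_g(f)(x)=t_{g(x)}(f(x))$. For a GL-rack $R$ and a medial GL-rack $(M,\mathtt{u}_2)$, the \emph{Hom GL-rack} is the set of GL-rack homomorphisms $R\to M$ with the same formula for the rack structure and with the GL-structure $f\mapsto\mathtt{u}_2f$. \textbf{Theorem.} Each of the categories $\mathsf{Rack}_{\mathrm{med}}$ and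 $\mathsf{GLR}_{\mathrm{med}}$ is closed symmetric monoidal, where the product of objects is the medial tensor product $\otimes_{\mathrm{med}}$, the unit is the free rack (respectively, the free GL-rack) on one element $e$, and the internal hom from $A$ to $B$ is the Hom rack (respectively, the Hom GL-rack) of homomorphisms $A\to B$. The structure morphisms are the canonical ones: for all morphisms $f:A\to A'$ and $g:B\to B'$ and all elements $a\in A$, $b\in B$, $c\in C$, $$(f\otimes g)(a\otimes b)=f(a)\otimes g(b),$$ the associator sends $(a\otimes b)\otimes c$ to $a\otimes(b\otimes c)$, the unitors send $e\otimes a$ and $a\otimes e$ to $a$, the symmetry sends $a\otimes b$ to $b\otimes a$, and the evaluation morphism, which is the counit of the adjunction between $A\otimes_{\mathrm{med}}-$ and $\operatorname{Hom}(A,-)$, sends $a\otimes h$ to $h(a)$ for every homomorphism $h:A\to B$. -/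

import Mathlib

open CategoryTheory MonoidalCategory
open scoped Quandles

universe u

/-! ## Quotients of racks by generated congruences -/

/-- The smallest congruence (equivalence relation compatible with both rack operations) on the
rack `R` that contains the relation `r`. -/
inductive Rack.CongrGen {R : Type u} [Rack R] (r : R → R → Prop) : R → R → Prop
  | of {x y : R} : r x y → Rack.CongrGen r x y
  | refl (x : R) : Rack.CongrGen r x x
  | symm {x y : R} : Rack.CongrGen r x y → Rack.CongrGen r y x
  | trans {x y z : R} : Rack.CongrGen r x y → Rack.CongrGen r y z → Rack.CongrGen r x z
  | act {x x' y y' : R} : Rack.CongrGen r x x' → Rack.CongrGen r y y' →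
      Rack.CongrGen r (x ◃ y) (x' ◃ y')
  | invAct {x x' y y' : R} : Rack.CongrGen r x x' → Rack.CongrGen r y y' →
      Rack.CongrGen r (x ◃⁻¹ y) (x' ◃⁻¹ y')

/-- `Rack.CongrGen r` as a setoid. -/
def Rack.congrSetoid {R : Type u} [Rack R] (r : R → R → Prop) : Setoid R where
  r := Rack.CongrGen r
  iseqv := ⟨.refl, .symm, .trans⟩

/-- The quotient of the rack `R` by the smallest congruence containing `r`. -/
def Rack.Quo {R : Type u} [Rack R] (r : R → R → Prop) : Type u :=
  Quotient (Rack.congrSetoid r)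

/-- The projection of a rack onto its quotient. -/
def Rack.Quo.mk {R : Type u} [Rack R] (r : R → R → Prop) (x : R) : Rack.Quo r :=
  Quotient.mk (Rack.congrSetoid r) x

instance Rack.Quo.rack {R : Type u} [Rack R] (r : R → R → Prop) : Rack (Rack.Quo r) where
  act := Quotient.map₂ (fun x y : R => x ◃ y) (fun _ _ h _ _ h' => Rack.CongrGen.act h h')
  self_distrib {x y z} := by
    induction x, y using Quotient.inductionOn₂
    induction z using Quotient.inductionOn
    exact congrArg (Rack.Quo.mk r) Shelf.self_distrib
  invAct := Quotient.map₂ (fun x y : R => x ◃⁻¹ y)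
    (fun _ _ h _ _ h' => Rack.CongrGen.invAct h h')
  left_inv x y := by
    induction x, y using Quotient.inductionOn₂
    exact congrArg (Rack.Quo.mk r) (Rack.left_inv _ _)
  right_inv x y := by
    induction x, y using Quotient.inductionOn₂
    exact congrArg (Rack.Quo.mk r) (Rack.right_inv _ _)

/-! ## Free racks, tensor products of racks, medialization, Hom racks -/

/-- Formal terms in the two rack operations, with variables from `X`. -/
inductive RackTerm (X : Type u) : Type u
  | of : X → RackTerm X
  | act : RackTerm X → RackTerm X → RackTerm X
  | invAct : RackTerm X → RackTerm X → RackTerm X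

/-- Equality of terms as a consequence of the rack axioms. -/
inductive RackTerm.Rel (X : Type u) : RackTerm X → RackTerm X → Prop
  | refl (a) : Rel X a a
  | symm {a b} : Rel X a b → Rel X b a
  | trans {a b c} : Rel X a b → Rel X b c → Rel X a c
  | act {a a' b b'} : Rel X a a' → Rel X b b' → Rel X (.act a b) (.act a' b')
  | invAct {a a' b b'} : Rel X a a' → Rel X b b' → Rel X (.invAct a b) (.invAct a' b')
  | self_distrib (a b c) : Rel X (.act a (.act b c)) (.act (.act a b) (.act a c))
  | left_inv (a b) : Rel X (.invAct a (.act a b)) b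
  | right_inv (a b) : Rel X (.act a (.invAct a b)) b

/-- `RackTerm.Rel` as a setoid. -/
def RackTerm.setoid (X : Type u) : Setoid (RackTerm X) where
  r := RackTerm.Rel X
  iseqv := ⟨.refl, .symm, .trans⟩

/-- The free rack on the set `X`. -/
def FreeRack (X : Type u) : Type u := Quotient (RackTerm.setoid X)

/-- The inclusion of the generators into the free rack. -/
def FreeRack.of {X : Type u} (x : X) : FreeRack X := Quotient.mk (RackTerm.setoid X) (.of x)

instance FreeRack.rack (X : Type u) : Rack (FreeRack X) where
  act := Quotient.map₂ RackTerm.act (fun _ _ h _ _ h' => RackTerm.Rel.act h h')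
  self_distrib {x y z} := by
    induction x, y using Quotient.inductionOn₂
    induction z using Quotient.inductionOn
    exact Quotient.sound (RackTerm.Rel.self_distrib _ _ _)
  invAct := Quotient.map₂ RackTerm.invAct (fun _ _ h _ _ h' => RackTerm.Rel.invAct h h')
  left_inv x y := by
    induction x, y using Quotient.inductionOn₂
    exact Quotient.sound (RackTerm.Rel.left_inv _ _)
  right_inv x y := by
    induction x, y using Quotient.inductionOn₂
    exact Quotient.sound (RackTerm.Rel.right_inv _ _)

theorem Rack.act_act_of_eq {R : Type u} [Rack R] (c p q : R) (hp : ∀ b, p ◃ b = c ◃ b)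
    (hq : ∀ b, q ◃ b = c ◃ b) (b : R) : (p ◃ q) ◃ b = c ◃ b := by
  have h : (p ◃ q) ◃ b = p ◃ q ◃ p ◃⁻¹ b := by rw [Shelf.self_distrib, Rack.act_invAct_eq]
  rw [h, hp, hq, ← hp (p ◃⁻¹ b), Rack.act_invAct_eq]

theorem Rack.invAct_act_of_eq {R : Type u} [Rack R] (c p q : R) (hp : ∀ b, p ◃ b = c ◃ b)
    (hq : ∀ b, q ◃ b = c ◃ b) (b : R) : (p ◃⁻¹ q) ◃ b = c ◃ b := by
  have h : (p ◃⁻¹ q) ◃ b = p ◃⁻¹ q ◃ p ◃ b := by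
    rw [← Rack.left_cancel p, Shelf.self_distrib, Rack.act_invAct_eq, Rack.act_invAct_eq]
  rw [h, hq, ← hp (p ◃ b), Rack.invAct_act_eq, hp]

/-- The free rack on one element is medial: all its elements act in the same way. -/
theorem FreeRack.isAbelian_punit : Rack.IsAbelian (FreeRack PUnit.{u + 1}) := by
  have key : ∀ a b : FreeRack PUnit.{u + 1}, a ◃ b = FreeRack.of PUnit.unit ◃ b := by
    intro a
    induction a using Quotient.inductionOn with
    | h t =>
      induction t with
      | of x => intro b; rfl
      | act s t hs ht => exact Rack.act_act_of_eq _ _ _ hs ht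
      | invAct s t hs ht => exact Rack.invAct_act_of_eq _ _ _ hs ht
  intro x y z w
  rw [key (x ◃ y), key (x ◃ z), key z, key y]

/-- The defining relations of the tensor product of two racks, on the free rack on `X × Y`. -/
inductive Rack.TensorRel (X Y : Type u) [Rack X] [Rack Y] :
    FreeRack (X × Y) → FreeRack (X × Y) → Prop
  | act_right (x : X) (y₁ y₂ : Y) :
      Rack.TensorRel X Y (FreeRack.of (x, y₂) ◃ FreeRack.of (x, y₁)) (FreeRack.of (x, y₂ ◃ y₁))
  | invAct_right (x : X) (y₁ y₂ : Y) :
      Rack.TensorRel X Y (FreeRack.of (x, y₂) ◃⁻¹ FreeRack.of (x, y₁))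
        (FreeRack.of (x, y₂ ◃⁻¹ y₁))
  | act_left (x₁ x₂ : X) (y : Y) :
      Rack.TensorRel X Y (FreeRack.of (x₂, y) ◃ FreeRack.of (x₁, y)) (FreeRack.of (x₂ ◃ x₁, y))
  | invAct_left (x₁ x₂ : X) (y : Y) :
      Rack.TensorRel X Y (FreeRack.of (x₂, y) ◃⁻¹ FreeRack.of (x₁, y))
        (FreeRack.of (x₂ ◃⁻¹ x₁, y))

/-- The universal-algebraic tensor product `X ⊗ Y` of racks. -/
abbrev Rack.Tensor (X Y : Type u) [Rack X] [Rack Y] : Type u :=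
  Rack.Quo (Rack.TensorRel X Y)

/-- The relations that force mediality. -/
inductive Rack.MedRel (R : Type u) [Rack R] : R → R → Prop
  | mk (x y z a : R) : Rack.MedRel R ((x ◃ z) ◃ (y ◃ a)) ((x ◃ y) ◃ (z ◃ a))

/-- The medialization of a rack. -/
abbrev Rack.Med (R : Type u) [Rack R] : Type u := Rack.Quo (Rack.MedRel R)

theorem Rack.Med.isAbelian (R : Type u) [Rack R] : Rack.IsAbelian (Rack.Med R) := by
  intro x y z w
  induction x, y using Quotient.inductionOn₂
  induction z, w using Quotient.inductionOn₂
  exact Quotient.sound (Rack.CongrGen.of (Rack.MedRel.mk _ _ _ _))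

/-- The medial tensor product of racks. -/
abbrev Rack.MedTensor (X Y : Type u) [Rack X] [Rack Y] : Type u := Rack.Med (Rack.Tensor X Y)

/-- The pure tensor `x ⊗ y` in the medial tensor product. -/
def Rack.MedTensor.tmul {X Y : Type u} [Rack X] [Rack Y] (x : X) (y : Y) : Rack.MedTensor X Y :=
  Rack.Quo.mk _ (Rack.Quo.mk _ (FreeRack.of (x, y)))

theorem ShelfHom.map_invAct' {X Y : Type u} [Rack X] [Rack Y] (f : X →◃ Y) (x y : X) :
    f (x ◃⁻¹ y) = f x ◃⁻¹ f y := by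
  rw [← Rack.left_cancel (f x), ← ShelfHom.map_act, Rack.act_invAct_eq, Rack.act_invAct_eq]

theorem Rack.IsAbelian.invAct_act {M : Type u} [Rack M] (h : Rack.IsAbelian M) (x y z w : M) :
    (x ◃ y) ◃⁻¹ (z ◃ w) = (x ◃⁻¹ z) ◃ (y ◃⁻¹ w) := by
  rw [← Rack.left_cancel (x ◃ y), Rack.act_invAct_eq, h, Rack.act_invAct_eq, Rack.act_invAct_eq]

/-- The rack structure on the set of homomorphisms from a rack to a medial rack, with
pointwise operations. -/
@[reducible]
def Rack.homRack (X : Type u) {M : Type u} [Rack X] [Rack M] (h : Rack.IsAbelian M) :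
    Rack (X →◃ M) where
  act g f := ⟨fun x => g x ◃ f x, fun {_ _} => by
    rw [ShelfHom.map_act, ShelfHom.map_act]; exact h _ _ _ _⟩
  self_distrib {_ _ _} := ShelfHom.ext (funext fun _ => Shelf.self_distrib)
  invAct g f := ⟨fun x => g x ◃⁻¹ f x, fun {x y} => by
    rw [ShelfHom.map_act, ShelfHom.map_act]; exact h.invAct_act _ _ _ _⟩
  left_inv _ _ := ShelfHom.ext (funext fun _ => Rack.left_inv _ _)
  right_inv _ _ := ShelfHom.ext (funext fun _ => Rack.right_inv _ _)

theorem Rack.homRack_isAbelian (X : Type u) {M : Type u} [Rack X] [Rack M]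
    (h : Rack.IsAbelian M) : @Rack.IsAbelian (X →◃ M) (Rack.homRack X h) :=
  fun _ _ _ _ => ShelfHom.ext (funext fun _ => h _ _ _ _)

/-! ## GL-racks -/

/-- A GL-rack: a rack with a rack automorphism `u` that commutes with all `x ◃ -`. -/
class GLRack (X : Type u) extends Rack X where
  /-- the GL-structure -/
  u : Equiv.Perm X
  u_map_act : ∀ x y : X, u (x ◃ y) = u x ◃ u y
  u_act : ∀ x y : X, u (x ◃ y) = x ◃ u y

/-- Homomorphisms of GL-racks. -/
@[ext]
structure GLRackHom (X Y : Type u) [GLRack X] [GLRack Y] extends X →◃ Y where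
  map_u' : ∀ x : X, toFun (GLRack.u x) = GLRack.u (toFun x)

instance GLRackHom.funLike (X Y : Type u) [GLRack X] [GLRack Y] : FunLike (GLRackHom X Y) X Y where
  coe f := f.toFun
  coe_injective _ _ h := GLRackHom.ext h

/-- The identity homomorphism. -/
def GLRackHom.id (X : Type u) [GLRack X] : GLRackHom X X where
  toShelfHom := ShelfHom.id X
  map_u' _ := rfl

/-- Composition of homomorphisms. -/
def GLRackHom.comp {X Y Z : Type u} [GLRack X] [GLRack Y] [GLRack Z] (g : GLRackHom Y Z)
    (f : GLRackHom X Y) : GLRackHom X Z where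
  toShelfHom := g.toShelfHom.comp f.toShelfHom
  map_u' x := (congrArg g.toFun (f.map_u' x)).trans (g.map_u' _)

/-- The smallest congruence (equivalence relation compatible with the rack operations, `u` and
its inverse) on the GL-rack `R` that contains the relation `r`. -/
inductive GLRack.CongrGen {R : Type u} [GLRack R] (r : R → R → Prop) : R → R → Prop
  | of {x y : R} : r x y → GLRack.CongrGen r x y
  | refl (x : R) : GLRack.CongrGen r x x
  | symm {x y : R} : GLRack.CongrGen r x y → GLRack.CongrGen r y x
  | trans {x y z : R} : GLRack.CongrGen r x y → GLRack.CongrGen r y z → GLRack.CongrGen r x z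
  | act {x x' y y' : R} : GLRack.CongrGen r x x' → GLRack.CongrGen r y y' →
      GLRack.CongrGen r (x ◃ y) (x' ◃ y')
  | invAct {x x' y y' : R} : GLRack.CongrGen r x x' → GLRack.CongrGen r y y' →
      GLRack.CongrGen r (x ◃⁻¹ y) (x' ◃⁻¹ y')
  | u {x x' : R} : GLRack.CongrGen r x x' → GLRack.CongrGen r (GLRack.u x) (GLRack.u x')
  | uInv {x x' : R} : GLRack.CongrGen r x x' →
      GLRack.CongrGen r (GLRack.u.symm x) (GLRack.u.symm x')

/-- `GLRack.CongrGen r` as a setoid. -/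
def GLRack.congrSetoid {R : Type u} [GLRack R] (r : R → R → Prop) : Setoid R where
  r := GLRack.CongrGen r
  iseqv := ⟨.refl, .symm, .trans⟩

/-- The quotient of the GL-rack `R` by the smallest congruence containing `r`. -/
def GLRack.Quo {R : Type u} [GLRack R] (r : R → R → Prop) : Type u :=
  Quotient (GLRack.congrSetoid r)

/-- The projection of a GL-rack onto its quotient. -/
def GLRack.Quo.mk {R : Type u} [GLRack R] (r : R → R → Prop) (x : R) : GLRack.Quo r :=
  Quotient.mk (GLRack.congrSetoid r) x

instance GLRack.Quo.glRack {R : Type u} [GLRack R] (r : R → R → Prop) :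
    GLRack (GLRack.Quo r) where
  act := Quotient.map₂ (fun x y : R => x ◃ y) (fun _ _ h _ _ h' => GLRack.CongrGen.act h h')
  self_distrib {x y z} := by
    induction x, y using Quotient.inductionOn₂
    induction z using Quotient.inductionOn
    exact congrArg (GLRack.Quo.mk r) Shelf.self_distrib
  invAct := Quotient.map₂ (fun x y : R => x ◃⁻¹ y)
    (fun _ _ h _ _ h' => GLRack.CongrGen.invAct h h')
  left_inv x y := by
    induction x, y using Quotient.inductionOn₂
    exact congrArg (GLRack.Quo.mk r) (Rack.left_inv _ _)
  right_inv x y := by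
    induction x, y using Quotient.inductionOn₂
    exact congrArg (GLRack.Quo.mk r) (Rack.right_inv _ _)
  u :=
    { toFun := Quotient.map (fun x : R => GLRack.u x) (fun _ _ h => GLRack.CongrGen.u h)
      invFun := Quotient.map (fun x : R => GLRack.u.symm x) (fun _ _ h => GLRack.CongrGen.uInv h)
      left_inv := fun x => by
        induction x using Quotient.inductionOn
        exact congrArg (GLRack.Quo.mk r) (Equiv.symm_apply_apply _ _)
      right_inv := fun x => by
        induction x using Quotient.inductionOn
        exact congrArg (GLRack.Quo.mk r) (Equiv.apply_symm_apply _ _) }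
  u_map_act x y := by
    induction x, y using Quotient.inductionOn₂
    exact congrArg (GLRack.Quo.mk r) (GLRack.u_map_act _ _)
  u_act x y := by
    induction x, y using Quotient.inductionOn₂
    exact congrArg (GLRack.Quo.mk r) (GLRack.u_act _ _)

/-- Formal terms in the operations of GL-racks, with variables from `X`. -/
inductive GLRackTerm (X : Type u) : Type u
  | of : X → GLRackTerm X
  | act : GLRackTerm X → GLRackTerm X → GLRackTerm X
  | invAct : GLRackTerm X → GLRackTerm X → GLRackTerm X
  | u : GLRackTerm X → GLRackTerm X
  | uInv : GLRackTerm X → GLRackTerm X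

/-- Equality of terms as a consequence of the GL-rack axioms. -/
inductive GLRackTerm.Rel (X : Type u) : GLRackTerm X → GLRackTerm X → Prop
  | refl (a) : Rel X a a
  | symm {a b} : Rel X a b → Rel X b a
  | trans {a b c} : Rel X a b → Rel X b c → Rel X a c
  | act {a a' b b'} : Rel X a a' → Rel X b b' → Rel X (.act a b) (.act a' b')
  | invAct {a a' b b'} : Rel X a a' → Rel X b b' → Rel X (.invAct a b) (.invAct a' b')
  | u {a a'} : Rel X a a' → Rel X (.u a) (.u a')
  | uInv {a a'} : Rel X a a' → Rel X (.uInv a) (.uInv a')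
  | self_distrib (a b c) : Rel X (.act a (.act b c)) (.act (.act a b) (.act a c))
  | left_inv (a b) : Rel X (.invAct a (.act a b)) b
  | right_inv (a b) : Rel X (.act a (.invAct a b)) b
  | u_left_inv (a) : Rel X (.uInv (.u a)) a
  | u_right_inv (a) : Rel X (.u (.uInv a)) a
  | u_map_act (a b) : Rel X (.u (.act a b)) (.act (.u a) (.u b))
  | u_act (a b) : Rel X (.u (.act a b)) (.act a (.u b))

/-- `GLRackTerm.Rel` as a setoid. -/
def GLRackTerm.setoid (X : Type u) : Setoid (GLRackTerm X) where
  r := GLRackTerm.Rel X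
  iseqv := ⟨.refl, .symm, .trans⟩

/-- The free GL-rack on the set `X`. -/
def FreeGLRack (X : Type u) : Type u := Quotient (GLRackTerm.setoid X)

/-- The inclusion of the generators into the free GL-rack. -/
def FreeGLRack.of {X : Type u} (x : X) : FreeGLRack X :=
  Quotient.mk (GLRackTerm.setoid X) (.of x)

instance FreeGLRack.glRack (X : Type u) : GLRack (FreeGLRack X) where
  act := Quotient.map₂ GLRackTerm.act (fun _ _ h _ _ h' => GLRackTerm.Rel.act h h')
  self_distrib {x y z} := by
    induction x, y using Quotient.inductionOn₂
    induction z using Quotient.inductionOn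
    exact Quotient.sound (GLRackTerm.Rel.self_distrib _ _ _)
  invAct := Quotient.map₂ GLRackTerm.invAct (fun _ _ h _ _ h' => GLRackTerm.Rel.invAct h h')
  left_inv x y := by
    induction x, y using Quotient.inductionOn₂
    exact Quotient.sound (GLRackTerm.Rel.left_inv _ _)
  right_inv x y := by
    induction x, y using Quotient.inductionOn₂
    exact Quotient.sound (GLRackTerm.Rel.right_inv _ _)
  u :=
    { toFun := Quotient.map GLRackTerm.u (fun _ _ h => GLRackTerm.Rel.u h)
      invFun := Quotient.map GLRackTerm.uInv (fun _ _ h => GLRackTerm.Rel.uInv h)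
      left_inv := fun x => by
        induction x using Quotient.inductionOn
        exact Quotient.sound (GLRackTerm.Rel.u_left_inv _)
      right_inv := fun x => by
        induction x using Quotient.inductionOn
        exact Quotient.sound (GLRackTerm.Rel.u_right_inv _) }
  u_map_act x y := by
    induction x, y using Quotient.inductionOn₂
    exact Quotient.sound (GLRackTerm.Rel.u_map_act _ _)
  u_act x y := by
    induction x, y using Quotient.inductionOn₂
    exact Quotient.sound (GLRackTerm.Rel.u_act _ _)

theorem GLRack.u_apply_act {R : Type u} [GLRack R] (x y : R) : GLRack.u x ◃ y = x ◃ y := by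
  obtain ⟨y, rfl⟩ := (GLRack.u (X := R)).surjective y
  rw [← GLRack.u_map_act, GLRack.u_act]

theorem GLRack.u_symm_apply_act {R : Type u} [GLRack R] (x y : R) :
    GLRack.u.symm x ◃ y = x ◃ y := by
  rw [← GLRack.u_apply_act, Equiv.apply_symm_apply]

/-- The free GL-rack on one element is medial: all its elements act in the same way. -/
theorem FreeGLRack.isAbelian_punit : Rack.IsAbelian (FreeGLRack PUnit.{u + 1}) := by
  have key : ∀ a b : FreeGLRack PUnit.{u + 1}, a ◃ b = FreeGLRack.of PUnit.unit ◃ b := by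
    intro a
    induction a using Quotient.inductionOn with
    | h t =>
      induction t with
      | of x => intro b; rfl
      | act s t hs ht => exact Rack.act_act_of_eq _ _ _ hs ht
      | invAct s t hs ht => exact Rack.invAct_act_of_eq _ _ _ hs ht
      | u s hs => exact fun b => (GLRack.u_apply_act _ b).trans (hs b)
      | uInv s hs => exact fun b => (GLRack.u_symm_apply_act _ b).trans (hs b)
  intro x y z w
  rw [key (x ◃ y), key (x ◃ z), key z, key y]

/-- The defining relations of the tensor product of two GL-racks, on the free GL-rack on
`X × Y`. -/
inductive GLRack.TensorRel (X Y : Type u) [GLRack X] [GLRack Y] :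
    FreeGLRack (X × Y) → FreeGLRack (X × Y) → Prop
  | act_right (x : X) (y₁ y₂ : Y) :
      GLRack.TensorRel X Y (FreeGLRack.of (x, y₂) ◃ FreeGLRack.of (x, y₁))
        (FreeGLRack.of (x, y₂ ◃ y₁))
  | invAct_right (x : X) (y₁ y₂ : Y) :
      GLRack.TensorRel X Y (FreeGLRack.of (x, y₂) ◃⁻¹ FreeGLRack.of (x, y₁))
        (FreeGLRack.of (x, y₂ ◃⁻¹ y₁))
  | act_left (x₁ x₂ : X) (y : Y) :
      GLRack.TensorRel X Y (FreeGLRack.of (x₂, y) ◃ FreeGLRack.of (x₁, y))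
        (FreeGLRack.of (x₂ ◃ x₁, y))
  | invAct_left (x₁ x₂ : X) (y : Y) :
      GLRack.TensorRel X Y (FreeGLRack.of (x₂, y) ◃⁻¹ FreeGLRack.of (x₁, y))
        (FreeGLRack.of (x₂ ◃⁻¹ x₁, y))
  | u_left (x : X) (y : Y) :
      GLRack.TensorRel X Y (GLRack.u (FreeGLRack.of (x, y))) (FreeGLRack.of (GLRack.u x, y))
  | u_right (x : X) (y : Y) :
      GLRack.TensorRel X Y (GLRack.u (FreeGLRack.of (x, y))) (FreeGLRack.of (x, GLRack.u y))

/-- The universal-algebraic tensor product `X ⊗ Y` of GL-racks. -/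
abbrev GLRack.Tensor (X Y : Type u) [GLRack X] [GLRack Y] : Type u :=
  GLRack.Quo (GLRack.TensorRel X Y)

/-- The medialization of a GL-rack. -/
abbrev GLRack.Med (R : Type u) [GLRack R] : Type u := GLRack.Quo (Rack.MedRel R)

theorem GLRack.Med.isAbelian (R : Type u) [GLRack R] : Rack.IsAbelian (GLRack.Med R) := by
  intro x y z w
  induction x, y using Quotient.inductionOn₂
  induction z, w using Quotient.inductionOn₂
  exact Quotient.sound (GLRack.CongrGen.of (Rack.MedRel.mk _ _ _ _))

/-- The medial tensor product of GL-racks. -/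
abbrev GLRack.MedTensor (X Y : Type u) [GLRack X] [GLRack Y] : Type u :=
  GLRack.Med (GLRack.Tensor X Y)

/-- The pure tensor `x ⊗ y` in the medial tensor product. -/
def GLRack.MedTensor.tmul {X Y : Type u} [GLRack X] [GLRack Y] (x : X) (y : Y) :
    GLRack.MedTensor X Y :=
  GLRack.Quo.mk _ (GLRack.Quo.mk _ (FreeGLRack.of (x, y)))

theorem GLRack.u_invAct {R : Type u} [GLRack R] (x y : R) :
    GLRack.u (x ◃⁻¹ y) = x ◃⁻¹ GLRack.u y := by
  rw [← Rack.left_cancel x, ← GLRack.u_act, Rack.act_invAct_eq, Rack.act_invAct_eq]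

theorem GLRack.u_apply_invAct {R : Type u} [GLRack R] (x y : R) :
    GLRack.u x ◃⁻¹ y = x ◃⁻¹ y := by
  rw [← Rack.left_cancel (GLRack.u x), Rack.act_invAct_eq, GLRack.u_apply_act,
    Rack.act_invAct_eq]

/-- The GL-rack structure on the set of homomorphisms from a GL-rack to a medial GL-rack:
the rack operations are pointwise, and `u` is postcomposition with the `u` of the target. -/
@[reducible]
def GLRack.homGLRack (X : Type u) {M : Type u} [GLRack X] [GLRack M] (h : Rack.IsAbelian M) :
    GLRack (GLRackHom X M) where
  act g f :=
    { toFun := fun x => g x ◃ f x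
      map_act' := ((Rack.homRack X h).act g.toShelfHom f.toShelfHom).map_act'
      map_u' := fun x => by
        rw [show g (GLRack.u x) = GLRack.u (g x) from g.map_u' x,
          show f (GLRack.u x) = GLRack.u (f x) from f.map_u' x, GLRack.u_map_act] }
  self_distrib {_ _ _} := GLRackHom.ext (funext fun _ => Shelf.self_distrib)
  invAct g f :=
    { toFun := fun x => g x ◃⁻¹ f x
      map_act' := ((Rack.homRack X h).invAct g.toShelfHom f.toShelfHom).map_act'
      map_u' := fun x => by
        rw [show g (GLRack.u x) = GLRack.u (g x) from g.map_u' x,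
          show f (GLRack.u x) = GLRack.u (f x) from f.map_u' x, GLRack.u_apply_invAct,
          GLRack.u_invAct] }
  left_inv _ _ := GLRackHom.ext (funext fun _ => Rack.left_inv _ _)
  right_inv _ _ := GLRackHom.ext (funext fun _ => Rack.right_inv _ _)
  u :=
    { toFun := fun f =>
        { toFun := fun x => GLRack.u (f x)
          map_act' := fun {x y} => by
            rw [show f (x ◃ y) = f x ◃ f y from f.map_act', GLRack.u_map_act]
          map_u' := fun x => congrArg GLRack.u (f.map_u' x) }
      invFun := fun f =>
        { toFun := fun x => GLRack.u.symm (f x)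
          map_act' := fun {x y} => by
            rw [show f (x ◃ y) = f x ◃ f y from f.map_act', Equiv.symm_apply_eq,
              GLRack.u_map_act, Equiv.apply_symm_apply, Equiv.apply_symm_apply]
          map_u' := fun x => by
            rw [show f (GLRack.u x) = GLRack.u (f x) from f.map_u' x, Equiv.symm_apply_apply,
              Equiv.apply_symm_apply] }
      left_inv := fun f => GLRackHom.ext (funext fun _ => Equiv.symm_apply_apply _ _)
      right_inv := fun f => GLRackHom.ext (funext fun _ => Equiv.apply_symm_apply _ _) }
  u_map_act _ _ := GLRackHom.ext (funext fun _ => GLRack.u_map_act _ _)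
  u_act _ _ := GLRackHom.ext (funext fun _ => GLRack.u_act _ _)

theorem GLRack.homGLRack_isAbelian (X : Type u) {M : Type u} [GLRack X] [GLRack M]
    (h : Rack.IsAbelian M) :
    @Rack.IsAbelian (GLRackHom X M) (GLRack.homGLRack X h).toRack :=
  fun _ _ _ _ => GLRackHom.ext (funext fun _ => h _ _ _ _)

/-! ## The categories -/

/-- The category of racks. -/
structure RackCat : Type (u + 1) where
  /-- the underlying set -/
  carrier : Type u
  [str : Rack carrier]

attribute [instance] RackCat.str

instance RackCat.coeSort : CoeSort RackCat.{u} (Type u) := ⟨RackCat.carrier⟩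

/-- Morphisms of `RackCat`: rack homomorphisms. -/
@[ext]
structure RackCat.Hom (X Y : RackCat.{u}) where
  /-- the underlying homomorphism -/
  hom' : X →◃ Y

instance RackCat.category : Category.{u} RackCat.{u} where
  Hom X Y := RackCat.Hom X Y
  id X := ⟨ShelfHom.id X⟩
  comp f g := ⟨g.hom'.comp f.hom'⟩

instance RackCat.concreteCategory : ConcreteCategory RackCat.{u} (fun X Y => X →◃ Y) where
  hom f := f.hom'
  ofHom f := ⟨f⟩

/-- The category of GL-racks. -/
structure GLRackCat : Type (u + 1) where
  /-- the underlying set -/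
  carrier : Type u
  [str : GLRack carrier]

attribute [instance] GLRackCat.str

instance GLRackCat.coeSort : CoeSort GLRackCat.{u} (Type u) := ⟨GLRackCat.carrier⟩

/-- Morphisms of `GLRackCat`: GL-rack homomorphisms. -/
@[ext]
structure GLRackCat.Hom (X Y : GLRackCat.{u}) where
  /-- the underlying homomorphism -/
  hom' : GLRackHom X Y

instance GLRackCat.category : Category.{u} GLRackCat.{u} where
  Hom X Y := GLRackCat.Hom X Y
  id X := ⟨GLRackHom.id X⟩
  comp f g := ⟨g.hom'.comp f.hom'⟩

instance GLRackCat.concreteCategory :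
    ConcreteCategory GLRackCat.{u} (fun X Y => GLRackHom X Y) where
  hom f := f.hom'
  ofHom f := ⟨f⟩

/-- The category of medial racks, a full subcategory of the category of racks. -/
abbrev MedRackCat : Type (u + 1) :=
  ObjectProperty.FullSubcategory (fun R : RackCat.{u} => Rack.IsAbelian R)

/-- The category of medial GL-racks, a full subcategory of the category of GL-racks. -/
abbrev MedGLRackCat : Type (u + 1) :=
  ObjectProperty.FullSubcategory (fun R : GLRackCat.{u} => Rack.IsAbelian R)

/-- The medial tensor product `A ⊗_med B` of medial racks. -/
def MedRackCat.tensor (A B : MedRackCat.{u}) : MedRackCat.{u} where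
  obj := ⟨Rack.MedTensor A.obj B.obj⟩
  property := Rack.Med.isAbelian _

/-- The free rack on one element. -/
def MedRackCat.unit : MedRackCat.{u} where
  obj := ⟨FreeRack PUnit.{u + 1}⟩
  property := FreeRack.isAbelian_punit

/-- The Hom rack of rack homomorphisms from `A` to `B`. -/
def MedRackCat.homObj (A B : MedRackCat.{u}) : MedRackCat.{u} where
  obj := @RackCat.mk (A.obj →◃ B.obj) (Rack.homRack A.obj B.property)
  property := Rack.homRack_isAbelian A.obj B.property

/-- The medial tensor product `A ⊗_med B` of medial GL-racks. -/
def MedGLRackCat.tensor (A B : MedGLRackCat.{u}) : MedGLRackCat.{u} where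
  obj := ⟨GLRack.MedTensor A.obj B.obj⟩
  property := GLRack.Med.isAbelian _

/-- The free GL-rack on one element. -/
def MedGLRackCat.unit : MedGLRackCat.{u} where
  obj := ⟨FreeGLRack PUnit.{u + 1}⟩
  property := FreeGLRack.isAbelian_punit

/-- The Hom GL-rack of GL-rack homomorphisms from `A` to `B`. -/
def MedGLRackCat.homObj (A B : MedGLRackCat.{u}) : MedGLRackCat.{u} where
  obj := @GLRackCat.mk (GLRackHom A.obj B.obj) (GLRack.homGLRack A.obj B.property)
  property := GLRack.homGLRack_isAbelian A.obj B.property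

/-- The element `a ⊗ b` of `A ⊗ B`, for a monoidal structure whose product of objects is the
medial tensor product of racks. -/
def MedRackCat.tmul [MonoidalCategory MedRackCat.{u}]
    (hT : ∀ A B : MedRackCat.{u}, A ⊗ B = MedRackCat.tensor A B)
    {A B : MedRackCat.{u}} (a : A.obj) (b : B.obj) : (A ⊗ B : MedRackCat.{u}).obj :=
  eqToHom (hT A B).symm (Rack.MedTensor.tmul a b : (MedRackCat.tensor A B).obj)

/-- The element `a ⊗ b` of `A ⊗ B`, for a monoidal structure whose product of objects is the
medial tensor product of GL-racks. -/
def MedGLRackCat.tmul [MonoidalCategory MedGLRackCat.{u}]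
    (hT : ∀ A B : MedGLRackCat.{u}, A ⊗ B = MedGLRackCat.tensor A B)
    {A B : MedGLRackCat.{u}} (a : A.obj) (b : B.obj) : (A ⊗ B : MedGLRackCat.{u}).obj :=
  eqToHom (hT A B).symm (GLRack.MedTensor.tmul a b : (MedGLRackCat.tensor A B).obj)

/-! The argument is the one for modules over a commutative ring. Call a map `A × B → D` a
bihomomorphism if it is a homomorphism in each variable. Mediality says that `◃` is itself a
homomorphism `M × M → M`, so pointwise products of homomorphisms into `M` are homomorphisms. Three
facts follow. The medial tensor product represents bihomomorphisms into medial objects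
(`Rack.MedTensor.lift`, `Rack.MedTensor.hom_ext`): its relations are exactly those that such a map
respects. Bihomomorphisms `K × A → B` are the same as homomorphisms from `K` to the Hom object,
whose operations are pointwise. Each element `t` of the free object on one generator acts on a
medial `A` by an endomorphism, namely `a ↦ φ t` with `φ` the homomorphism taking the generator to
`a` (`FreeRack.lift_act`), and the generator acts as the identity.

Everything else is formal and is done once, for a concrete category with the data `BihomTensor`,
which is then instantiated for racks and for GL-racks. The associator comes from the universal
property of triple tensor products, which closedness reduces to that of double ones
(`exists_lift₃`). All coherence diagrams commute because both sides agree on iterated pure tensors,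
and homomorphisms are determined there (`hom_ext_assoc`, `hom_ext_assoc₄`). The adjunction is
currying. -/

namespace CategoryTheory

universe w v w'

/-! ### Maps that are homomorphisms in each variable -/

section IsHom

variable {C : Type w} [Category.{v} C] {FC : C → C → Type*} {CC : C → Type w'}
  [∀ X Y, FunLike (FC X Y) (CC X) (CC Y)] [ConcreteCategory C FC]

/-- The function `f` between objects of a concrete category underlies a morphism. -/
def IsHom {A B : C} (f : ToType A → ToType B) : Prop := ∃ g : A ⟶ B, ∀ a, g a = f a

theorem IsHom.of {A B : C} (f : A ⟶ B) : IsHom fun a : ToType A => f a := ⟨f, fun _ => rfl⟩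

theorem IsHom.id {A : C} : IsHom fun a : ToType A => a := ⟨𝟙 A, by simp⟩

theorem IsHom.comp {A B D : C} {g : ToType B → ToType D} {f : ToType A → ToType B}
    (hg : IsHom g) (hf : IsHom f) : IsHom fun a => g (f a) := by
  obtain ⟨g', hg⟩ := hg
  obtain ⟨f', hf⟩ := hf
  exact ⟨f' ≫ g', fun a => by rw [ConcreteCategory.comp_apply, hf, hg]⟩

/-- The map `f` underlies a morphism in each of its two variables. -/
structure IsBihom {A B D : C} (f : ToType A → ToType B → ToType D) : Prop where
  left (b : ToType B) : IsHom fun a => f a b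
  right (a : ToType A) : IsHom (f a)

theorem IsBihom.flip {A B D : C} {f : ToType A → ToType B → ToType D} (hf : IsBihom f) :
    IsBihom fun b a => f a b := ⟨hf.right, hf.left⟩

theorem IsBihom.comp₂ {A B A' B' D : C} {f : ToType A → ToType B → ToType D} (hf : IsBihom f)
    {g : ToType A' → ToType A} {h : ToType B' → ToType B} (hg : IsHom g) (hh : IsHom h) :
    IsBihom fun a b => f (g a) (h b) :=
  ⟨fun b => (hf.left (h b)).comp hg, fun a => (hf.right (g a)).comp hh⟩

theorem IsHom.comp_bihom {A B D E : C} {f : ToType A → ToType B → ToType D}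
    {g : ToType D → ToType E} (hg : IsHom g) (hf : IsBihom f) : IsBihom fun a b => g (f a b) :=
  ⟨fun b => hg.comp (hf.left b), fun a => hg.comp (hf.right a)⟩

end IsHom

/-! ### The axioms behind the closed symmetric structure -/

/-- A tensor product classifying the maps that are morphisms in each variable, a unit which is free
on one element, and internal homs with pointwise structure, on a concrete category. -/
structure BihomTensor (C : Type w) [Category.{v} C] {FC : C → C → Type*} {CC : C → Type w'}
    [∀ X Y, FunLike (FC X Y) (CC X) (CC Y)] [ConcreteCategory C FC] where
  /-- the tensor product of objects -/
  tensor : C → C → C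
  /-- pure tensors -/
  tmul {A B : C} : ToType A → ToType B → ToType (tensor A B)
  isBihom_tmul (A B : C) : IsBihom (tmul : ToType A → ToType B → _)
  exists_lift {A B D : C} (f : ToType A → ToType B → ToType D) (hf : IsBihom f) :
    ∃ g : tensor A B ⟶ D, ∀ a b, g (tmul a b) = f a b
  hom_ext {A B D : C} (f g : tensor A B ⟶ D) (h : ∀ a b, f (tmul a b) = g (tmul a b)) : f = g
  /-- the unit object -/
  unit : C
  /-- the generator of the unit object -/
  gen : ToType unit
  -- More than freeness on `gen`: every element of the unit must act on `A` by an endomorphism. This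
  -- is what makes the left unitor a morphism out of the tensor product.
  unit_exists_bihom (A : C) : ∃ f : ToType unit → ToType A → ToType A,
    IsBihom f ∧ ∀ a, f gen a = a
  unit_hom_ext {A : C} (f g : unit ⟶ A) (h : f gen = g gen) : f = g
  /-- the internal hom -/
  hom : C → C → C
  /-- elements of the internal hom are morphisms -/
  homEquiv {A B : C} : ToType (hom A B) ≃ (A ⟶ B)
  isHom_eval {A B : C} (a : ToType A) : IsHom fun h : ToType (hom A B) => homEquiv h a
  exists_curry {K A B : C} (f : ToType K → ToType A → ToType B) (hf : IsBihom f) :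
    ∃ g : K ⟶ hom A B, ∀ k a, homEquiv (g k) a = f k a

/-! ### Universal properties and extensionality on pure tensors -/

namespace BihomTensor

variable {C : Type w} [Category.{v} C] {FC : C → C → Type*} {CC : C → Type w'}
  [∀ X Y, FunLike (FC X Y) (CC X) (CC Y)] [ConcreteCategory C FC] (T : BihomTensor C)

/-- The morphism out of the tensor product induced by a map that is a morphism in each variable. -/
noncomputable def lift {A B D : C} (f : ToType A → ToType B → ToType D) (hf : IsBihom f) :
    T.tensor A B ⟶ D := (T.exists_lift f hf).choose

@[simp]
theorem lift_tmul {A B D : C} (f : ToType A → ToType B → ToType D) (hf : IsBihom f) (a : ToType A)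
    (b : ToType B) : T.lift f hf (T.tmul a b) = f a b := (T.exists_lift f hf).choose_spec a b

/-- The morphism to the internal hom induced by a map that is a morphism in each variable. -/
noncomputable def curry {K A B : C} (f : ToType K → ToType A → ToType B) (hf : IsBihom f) :
    K ⟶ T.hom A B := (T.exists_curry f hf).choose

@[simp]
theorem homEquiv_curry {K A B : C} (f : ToType K → ToType A → ToType B) (hf : IsBihom f)
    (k : ToType K) (a : ToType A) : T.homEquiv (T.curry f hf k) a = f k a :=
  (T.exists_curry f hf).choose_spec k a

theorem isBihom_homEquiv (A B : C) :
    IsBihom fun (h : ToType (T.hom A B)) (a : ToType A) => T.homEquiv h a :=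
  ⟨T.isHom_eval, fun _ => .of _⟩

theorem hom_elt_ext {A B : C} {h h' : ToType (T.hom A B)}
    (H : ∀ a, T.homEquiv h a = T.homEquiv h' a) : h = h' :=
  T.homEquiv.injective (ConcreteCategory.hom_ext _ _ H)

/-- To compare two homomorphisms on a tensor product, it is enough to compare them on pure
tensors. -/
theorem induction_tmul {A B D : C} {p q : ToType (T.tensor A B) → ToType D} (hp : IsHom p)
    (hq : IsHom q) (h : ∀ a b, p (T.tmul a b) = q (T.tmul a b)) (t : ToType (T.tensor A B)) :
    p t = q t := by
  obtain ⟨p', hp⟩ := hp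
  obtain ⟨q', hq⟩ := hq
  rw [← hp, ← hq, T.hom_ext p' q' fun a b => by rw [hp, hq, h]]

theorem induction_unit {D : C} {p q : ToType T.unit → ToType D} (hp : IsHom p)
    (hq : IsHom q) (h : p T.gen = q T.gen) (t : ToType T.unit) : p t = q t := by
  obtain ⟨p', hp⟩ := hp
  obtain ⟨q', hq⟩ := hq
  rw [← hp, ← hq, T.unit_hom_ext p' q' (by rw [hp, hq, h])]

theorem tmul_left (A : C) {B : C} (b : ToType B) : IsHom fun a : ToType A => T.tmul a b :=
  (T.isBihom_tmul A B).left b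

theorem tmul_right {A : C} (B : C) (a : ToType A) : IsHom fun b : ToType B => T.tmul a b :=
  (T.isBihom_tmul A B).right a

/-- An element `t` of `A ⊗ B` need not be a pure tensor. But for fixed `d` both sides are
homomorphisms in `t`, so they agree as soon as they do on pure `t`. -/
theorem hom_ext_assoc {A B D E : C} (f g : T.tensor (T.tensor A B) D ⟶ E)
    (h : ∀ a b d, f (T.tmul (T.tmul a b) d) = g (T.tmul (T.tmul a b) d)) : f = g :=
  T.hom_ext _ _ fun t d => T.induction_tmul ((IsHom.of f).comp (T.tmul_left _ d))
    ((IsHom.of g).comp (T.tmul_left _ d)) (fun a b => h a b d) t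

theorem hom_ext_assoc' {A B D E : C} (f g : T.tensor A (T.tensor B D) ⟶ E)
    (h : ∀ a b d, f (T.tmul a (T.tmul b d)) = g (T.tmul a (T.tmul b d))) : f = g :=
  T.hom_ext _ _ fun a t => T.induction_tmul ((IsHom.of f).comp (T.tmul_right _ a))
    ((IsHom.of g).comp (T.tmul_right _ a)) (fun b d => h a b d) t

/-- The case needed for the pentagon: with the last two factors fixed, both sides are again
homomorphisms in the first. -/
theorem hom_ext_assoc₄ {A B D E F : C} (f g : T.tensor (T.tensor (T.tensor A B) D) E ⟶ F)
    (h : ∀ a b d e, f (T.tmul (T.tmul (T.tmul a b) d) e) =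
      g (T.tmul (T.tmul (T.tmul a b) d) e)) : f = g :=
  T.hom_ext_assoc _ _ fun t d e => T.induction_tmul
    ((IsHom.of f).comp ((T.tmul_left _ e).comp (T.tmul_left _ d)))
    ((IsHom.of g).comp ((T.tmul_left _ e).comp (T.tmul_left _ d))) (fun a b => h a b d e) t

/-! ### Structure morphisms -/

/-- The tensor product of morphisms. -/
noncomputable def map {A A' B B' : C} (f : A ⟶ A') (g : B ⟶ B') : T.tensor A B ⟶ T.tensor A' B' :=
  T.lift (fun a b => T.tmul (f a) (g b)) ((T.isBihom_tmul _ _).comp₂ (.of f) (.of g))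

@[simp]
theorem map_tmul {A A' B B' : C} (f : A ⟶ A') (g : B ⟶ B') (a : ToType A) (b : ToType B) :
    T.map f g (T.tmul a b) = T.tmul (f a) (g b) := T.lift_tmul _ _ _ _

/-- The symmetry. -/
noncomputable def swap (A B : C) : T.tensor A B ⟶ T.tensor B A :=
  T.lift (fun a b => T.tmul b a) (T.isBihom_tmul _ _).flip

@[simp]
theorem swap_tmul {A B : C} (a : ToType A) (b : ToType B) :
    T.swap A B (T.tmul a b) = T.tmul b a := T.lift_tmul _ _ _ _

/-- Curry away the last variable: a trihomomorphism to `E` is a bihomomorphism from `A × B` to the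
internal hom of `D` and `E`. It factors through `A ⊗ B`, and uncurrying gives the morphism sought.
-/
theorem exists_lift₃ {A B D E : C} (f : ToType A → ToType B → ToType D → ToType E)
    (hf : ∀ d, IsBihom fun a b => f a b d) (hf' : ∀ a b, IsHom (f a b)) :
    ∃ g : T.tensor (T.tensor A B) D ⟶ E, ∀ a b d, g (T.tmul (T.tmul a b) d) = f a b d := by
  let c (a : ToType A) : B ⟶ T.hom D E := T.curry (f a) ⟨fun d => (hf d).right a, hf' a⟩
  have hc : IsBihom fun a b => c a b :=
    -- In the variable `a`, the witness is the map curried from `A × D` with `b` fixed; it has the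
    -- same values as `c` at every `d`.
    ⟨fun b => ⟨T.curry (fun a => f a b) ⟨fun d => (hf d).left b, fun a => hf' a b⟩,
      fun a => T.hom_elt_ext fun d => by simp [c]⟩, fun a => .of (c a)⟩
  exact ⟨T.lift (fun t d => T.homEquiv (T.lift _ hc t) d)
    ((T.isBihom_homEquiv D E).comp₂ (.of _) .id), fun a b d => by simp [c]⟩

/-- The other bracketing is the previous one with the variables rotated, precomposed with the
symmetry. -/
theorem exists_lift₃' {A B D E : C} (f : ToType A → ToType B → ToType D → ToType E)
    (hf : ∀ d, IsBihom fun a b => f a b d) (hf' : ∀ a b, IsHom (f a b)) :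
    ∃ g : T.tensor A (T.tensor B D) ⟶ E, ∀ a b d, g (T.tmul a (T.tmul b d)) = f a b d := by
  obtain ⟨g, hg⟩ := T.exists_lift₃ (fun b d a => f a b d)
    (fun a => ⟨fun d => (hf d).right a, fun b => hf' a b⟩) (fun b d => (hf d).left b)
  exact ⟨T.swap _ _ ≫ g, fun a b d => by simp [hg]⟩

theorem exists_assoc (A B D : C) : ∃ g : T.tensor (T.tensor A B) D ⟶ T.tensor A (T.tensor B D),
    ∀ a b d, g (T.tmul (T.tmul a b) d) = T.tmul a (T.tmul b d) :=
  T.exists_lift₃ (fun a b d => T.tmul a (T.tmul b d))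
    (fun d => (T.isBihom_tmul _ _).comp₂ .id (T.tmul_left _ d))
    (fun a b => (T.tmul_right _ a).comp (T.tmul_right _ b))

theorem exists_assoc_inv (A B D : C) :
    ∃ g : T.tensor A (T.tensor B D) ⟶ T.tensor (T.tensor A B) D,
    ∀ a b d, g (T.tmul a (T.tmul b d)) = T.tmul (T.tmul a b) d :=
  T.exists_lift₃' (fun a b d => T.tmul (T.tmul a b) d)
    (fun d => (T.tmul_left _ d).comp_bihom (T.isBihom_tmul _ _))
    (fun a b => T.tmul_right _ (T.tmul a b))

/-- The associator. -/
noncomputable def assoc (A B D : C) :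
    T.tensor (T.tensor A B) D ≅ T.tensor A (T.tensor B D) where
  hom := (T.exists_assoc A B D).choose
  inv := (T.exists_assoc_inv A B D).choose
  hom_inv_id := T.hom_ext_assoc _ _ fun a b d => by
    simp [(T.exists_assoc A B D).choose_spec, (T.exists_assoc_inv A B D).choose_spec]
  inv_hom_id := T.hom_ext_assoc' _ _ fun a b d => by
    simp [(T.exists_assoc A B D).choose_spec, (T.exists_assoc_inv A B D).choose_spec]

@[simp]
theorem assoc_hom_tmul {A B D : C} (a : ToType A) (b : ToType B) (d : ToType D) :
    (T.assoc A B D).hom (T.tmul (T.tmul a b) d) = T.tmul a (T.tmul b d) :=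
  (T.exists_assoc A B D).choose_spec a b d

@[simp]
theorem assoc_inv_tmul {A B D : C} (a : ToType A) (b : ToType B) (d : ToType D) :
    (T.assoc A B D).inv (T.tmul a (T.tmul b d)) = T.tmul (T.tmul a b) d :=
  (T.exists_assoc_inv A B D).choose_spec a b d

theorem unit_tensor_hom_ext {A D : C} (f g : T.tensor T.unit A ⟶ D)
    (h : ∀ a, f (T.tmul T.gen a) = g (T.tmul T.gen a)) : f = g :=
  T.hom_ext _ _ fun x a => T.induction_unit ((IsHom.of f).comp (T.tmul_left _ a))
    ((IsHom.of g).comp (T.tmul_left _ a)) (h a) x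

/-- The inverse is `a ↦ gen ⊗ a`. That it is a left inverse needs checking only on `gen ⊗ a`, since
`gen` generates the unit. -/
theorem exists_leftUnitor (A : C) : ∃ g : T.tensor T.unit A ≅ A,
    ∀ a, g.hom (T.tmul T.gen a) = a := by
  obtain ⟨f, hf, hgen⟩ := T.unit_exists_bihom A
  obtain ⟨i, hi⟩ := T.tmul_right A T.gen
  exact ⟨⟨T.lift f hf, i, T.unit_tensor_hom_ext _ _ fun a => by simp [hgen, hi],
    ConcreteCategory.hom_ext _ _ fun a => by simp [hi, hgen]⟩, fun a => by simp [hgen]⟩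

/-- The left unitor. -/
noncomputable def leftUnitor (A : C) : T.tensor T.unit A ≅ A := (T.exists_leftUnitor A).choose

@[simp]
theorem leftUnitor_hom_tmul {A : C} (a : ToType A) :
    (T.leftUnitor A).hom (T.tmul T.gen a) = a := (T.exists_leftUnitor A).choose_spec a

/-- The symmetry as an isomorphism. -/
@[simps]
noncomputable def braiding (A B : C) : T.tensor A B ≅ T.tensor B A where
  hom := T.swap A B
  inv := T.swap B A
  hom_inv_id := T.hom_ext _ _ fun a b => by simp
  inv_hom_id := T.hom_ext _ _ fun a b => by simp

/-- The right unitor. -/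
noncomputable def rightUnitor (A : C) : T.tensor A T.unit ≅ A :=
  T.braiding A T.unit ≪≫ T.leftUnitor A

@[simp]
theorem rightUnitor_hom_tmul {A : C} (a : ToType A) :
    (T.rightUnitor A).hom (T.tmul a T.gen) = a := by simp [rightUnitor]

theorem tensor_unit_hom_ext {A D : C} (f g : T.tensor A T.unit ⟶ D)
    (h : ∀ a, f (T.tmul a T.gen) = g (T.tmul a T.gen)) : f = g :=
  T.hom_ext _ _ fun a x => T.induction_unit ((IsHom.of f).comp (T.tmul_right _ a))
    ((IsHom.of g).comp (T.tmul_right _ a)) (h a) x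

/-- Serves the triangle identity, where the unit sits in the middle. -/
theorem tensor_unit_tensor_hom_ext {A B D : C} (f g : T.tensor (T.tensor A T.unit) B ⟶ D)
    (h : ∀ a b, f (T.tmul (T.tmul a T.gen) b) = g (T.tmul (T.tmul a T.gen) b)) : f = g :=
  T.hom_ext_assoc _ _ fun a x b =>
    T.induction_unit ((IsHom.of f).comp ((T.tmul_left _ b).comp (T.tmul_right _ a)))
      ((IsHom.of g).comp ((T.tmul_left _ b).comp (T.tmul_right _ a))) (h a b) x

/-! ### Functoriality, naturality and coherence -/

theorem map_id_id (A B : C) : T.map (𝟙 A) (𝟙 B) = 𝟙 (T.tensor A B) :=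
  T.hom_ext _ _ fun a b => by simp

theorem map_comp_map {A₁ A₂ A₃ B₁ B₂ B₃ : C} (f₁ : A₁ ⟶ A₂) (f₂ : B₁ ⟶ B₂) (g₁ : A₂ ⟶ A₃)
    (g₂ : B₂ ⟶ B₃) : T.map f₁ f₂ ≫ T.map g₁ g₂ = T.map (f₁ ≫ g₁) (f₂ ≫ g₂) :=
  T.hom_ext _ _ fun a b => by simp

theorem assoc_naturality {A A' B B' D D' : C} (f : A ⟶ A') (g : B ⟶ B') (h : D ⟶ D') :
    T.map (T.map f g) h ≫ (T.assoc A' B' D').hom = (T.assoc A B D).hom ≫ T.map f (T.map g h) :=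
  T.hom_ext_assoc _ _ fun a b d => by simp

theorem leftUnitor_naturality {A B : C} (f : A ⟶ B) :
    T.map (𝟙 T.unit) f ≫ (T.leftUnitor B).hom = (T.leftUnitor A).hom ≫ f :=
  T.unit_tensor_hom_ext _ _ fun a => by simp

theorem rightUnitor_naturality {A B : C} (f : A ⟶ B) :
    T.map f (𝟙 T.unit) ≫ (T.rightUnitor B).hom = (T.rightUnitor A).hom ≫ f :=
  T.tensor_unit_hom_ext _ _ fun a => by simp

theorem pentagon (A B D E : C) :
    T.map (T.assoc A B D).hom (𝟙 E) ≫ (T.assoc A (T.tensor B D) E).hom ≫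
      T.map (𝟙 A) (T.assoc B D E).hom =
    (T.assoc (T.tensor A B) D E).hom ≫ (T.assoc A B (T.tensor D E)).hom :=
  T.hom_ext_assoc₄ _ _ fun a b d e => by simp

theorem triangle (A B : C) :
    (T.assoc A T.unit B).hom ≫ T.map (𝟙 A) (T.leftUnitor B).hom =
      T.map (T.rightUnitor A).hom (𝟙 B) :=
  T.tensor_unit_tensor_hom_ext _ _ fun a b => by simp

theorem swap_naturality {A A' B B' : C} (f : A ⟶ A') (g : B ⟶ B') :
    T.map f g ≫ T.swap A' B' = T.swap A B ≫ T.map g f :=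
  T.hom_ext _ _ fun a b => by simp

theorem hexagon_forward (A B D : C) :
    (T.assoc A B D).hom ≫ T.swap A (T.tensor B D) ≫ (T.assoc B D A).hom =
      T.map (T.swap A B) (𝟙 D) ≫ (T.assoc B A D).hom ≫ T.map (𝟙 B) (T.swap A D) :=
  T.hom_ext_assoc _ _ fun a b d => by simp

theorem hexagon_reverse (A B D : C) :
    (T.assoc A B D).inv ≫ T.swap (T.tensor A B) D ≫ (T.assoc D A B).inv =
      T.map (𝟙 A) (T.swap B D) ≫ (T.assoc A D B).inv ≫ T.map (T.swap A D) (𝟙 B) :=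
  T.hom_ext_assoc' _ _ fun a b d => by simp

/-! ### Monoidal, symmetric and closed structures -/

/-- The monoidal structure given by the tensor product. -/
@[reducible]
noncomputable def monoidalCategory : MonoidalCategory C :=
  letI : MonoidalCategoryStruct C :=
    { tensorObj := T.tensor
      whiskerLeft := fun A _ _ g => T.map (𝟙 A) g
      whiskerRight := fun f B => T.map f (𝟙 B)
      tensorHom := T.map
      tensorUnit := T.unit
      associator := T.assoc
      leftUnitor := T.leftUnitor
      rightUnitor := T.rightUnitor }
  .ofTensorHom T.map_id_id (fun _ _ _ _ => rfl) (fun _ _ => rfl) T.map_comp_map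
    T.assoc_naturality T.leftUnitor_naturality T.rightUnitor_naturality T.pentagon T.triangle

/-- The symmetric structure given by the exchange of the factors. -/
@[reducible]
noncomputable def symmetricCategory : @SymmetricCategory C _ T.monoidalCategory :=
  letI := T.monoidalCategory
  { braiding := T.braiding
    braiding_naturality_right := fun A _ _ f => T.swap_naturality (𝟙 A) f
    braiding_naturality_left := fun f B => T.swap_naturality f (𝟙 B)
    hexagon_forward := T.hexagon_forward
    hexagon_reverse := T.hexagon_reverse
    symmetry := fun A B => (T.braiding A B).hom_inv_id }

/-- Morphisms out of `A ⊗ B` correspond to morphisms from `B` to the internal hom. -/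
noncomputable def tensorHomEquiv (A B D : C) : (T.tensor A B ⟶ D) ≃ (B ⟶ T.hom A D) where
  toFun f := T.curry (fun b a => f (T.tmul a b))
    ((IsHom.of f).comp_bihom (T.isBihom_tmul A B).flip)
  invFun g := T.lift (fun a b => T.homEquiv (g b) a)
    ((T.isBihom_homEquiv A D).comp₂ (.of g) .id).flip
  left_inv f := T.hom_ext _ _ fun a b => by simp
  right_inv g := ConcreteCategory.hom_ext _ _ fun b => T.hom_elt_ext fun a => by simp

@[simp]
theorem homEquiv_tensorHomEquiv {A B D : C} (f : T.tensor A B ⟶ D) (a : ToType A) (b : ToType B) :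
    T.homEquiv (T.tensorHomEquiv A B D f b) a = f (T.tmul a b) := by
  simp [tensorHomEquiv]

@[simp]
theorem tensorHomEquiv_symm_tmul {A B D : C} (g : B ⟶ T.hom A D) (a : ToType A) (b : ToType B) :
    (T.tensorHomEquiv A B D).symm g (T.tmul a b) = T.homEquiv (g b) a := by
  simp [tensorHomEquiv]

/-- The closed structure given by the internal hom. -/
@[reducible]
noncomputable def monoidalClosed : @MonoidalClosed C _ T.monoidalCategory :=
  letI := T.monoidalCategory
  -- Naturality of currying in the source; functoriality of the internal hom in its target is
  -- derived from it.
  have he (A B B' D : C) (f : B' ⟶ B) (g : T.tensor A B ⟶ D) :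
      T.tensorHomEquiv A B' D (T.map (𝟙 A) f ≫ g) = f ≫ T.tensorHomEquiv A B D g :=
    ConcreteCategory.hom_ext _ _ fun b => T.hom_elt_ext fun a => by simp
  -- This construction of the right adjoint keeps `T.hom A` as its map on objects, and its counit is
  -- the transpose of the identity.
  { closed := fun A =>
      { rightAdj := Adjunction.rightAdjointOfEquiv (F := tensorLeft A)
          (fun B D => T.tensorHomEquiv A B D) (fun _ _ _ f g => he A _ _ _ f g)
        adj := Adjunction.adjunctionOfEquivRight (F := tensorLeft A)
          (fun B D => T.tensorHomEquiv A B D) (fun _ _ _ f g => he A _ _ _ f g) } }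

end BihomTensor

end CategoryTheory

/-! ## Universal properties of free racks, quotients and medial tensor products -/

/-- The value of a term in a rack. -/
def RackTerm.eval {X R : Type u} [Rack R] (f : X → R) : RackTerm X → R
  | .of x => f x
  | .act a b => eval f a ◃ eval f b
  | .invAct a b => eval f a ◃⁻¹ eval f b

/-- Having equal values in `R` satisfies every rule that generates `RackTerm.Rel`, because `R` is a
rack. -/
theorem RackTerm.eval_eq {X R : Type u} [Rack R] (f : X → R) {a b : RackTerm X}
    (h : RackTerm.Rel X a b) : a.eval f = b.eval f := by
  induction h with
  | refl => rfl
  | symm _ ih => exact ih.symm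
  | trans _ _ ih ih' => exact ih.trans ih'
  | act _ _ ih ih' => exact congrArg₂ (· ◃ ·) ih ih'
  | invAct _ _ ih ih' => exact congrArg₂ (· ◃⁻¹ ·) ih ih'
  | self_distrib => exact Shelf.self_distrib
  | left_inv => exact Rack.left_inv _ _
  | right_inv => exact Rack.right_inv _ _

/-- The homomorphism from the free rack that extends a map on generators. -/
def FreeRack.lift {X R : Type u} [Rack R] (f : X → R) : FreeRack X →◃ R where
  toFun := Quotient.lift (RackTerm.eval f) fun _ _ h => RackTerm.eval_eq f h
  map_act' {x y} := by
    induction x, y using Quotient.inductionOn₂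
    rfl

theorem FreeRack.hom_ext {X R : Type u} [Rack R] {f g : FreeRack X →◃ R}
    (h : ∀ x, f (FreeRack.of x) = g (FreeRack.of x)) (a : FreeRack X) : f a = g a := by
  induction a using Quotient.inductionOn with
  | h t =>
    induction t with
    | of x => exact h x
    | act s t hs ht =>
      exact (f.map_act (x := Quotient.mk _ s) (y := Quotient.mk _ t)).trans
        ((congrArg₂ _ hs ht).trans g.map_act.symm)
    | invAct s t hs ht =>
      exact (f.map_invAct' (Quotient.mk _ s) (Quotient.mk _ t)).trans
        ((congrArg₂ _ hs ht).trans (g.map_invAct' _ _).symm)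

/-- The kernel of `f` is a congruence, as `f` also preserves `◃⁻¹`; hence it contains the smallest
congruence containing `r`. -/
theorem Rack.CongrGen.map_eq {R S : Type u} [Rack R] [Rack S] {r : R → R → Prop} (f : R →◃ S)
    (h : ∀ x y, r x y → f x = f y) {x y : R} (hxy : Rack.CongrGen r x y) : f x = f y := by
  induction hxy with
  | of hr => exact h _ _ hr
  | refl => rfl
  | symm _ ih => exact ih.symm
  | trans _ _ ih ih' => exact ih.trans ih'
  | act _ _ ih ih' => rw [f.map_act, f.map_act, ih, ih']
  | invAct _ _ ih ih' => rw [f.map_invAct', f.map_invAct', ih, ih']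

/-- The homomorphism from the quotient of a rack induced by a homomorphism that respects the
relation. -/
def Rack.Quo.lift {R S : Type u} [Rack R] [Rack S] {r : R → R → Prop} (f : R →◃ S)
    (h : ∀ x y, r x y → f x = f y) : Rack.Quo r →◃ S where
  toFun := Quotient.lift f fun _ _ hxy => Rack.CongrGen.map_eq f h hxy
  map_act' {x y} := by
    induction x, y using Quotient.inductionOn₂
    exact f.map_act

/-- The projection of a rack onto its quotient, as a homomorphism. -/
def Rack.Quo.mkHom {R : Type u} [Rack R] (r : R → R → Prop) : R →◃ Rack.Quo r where
  toFun := Rack.Quo.mk r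
  map_act' := rfl

theorem Rack.Quo.sound {R : Type u} [Rack R] {r : R → R → Prop} {x y : R} (h : r x y) :
    Rack.Quo.mk r x = Rack.Quo.mk r y := Quotient.sound (Rack.CongrGen.of h)

theorem Rack.MedTensor.act_tmul {X Y : Type u} [Rack X] [Rack Y] (x x' : X) (y : Y) :
    Rack.MedTensor.tmul (x ◃ x') y = Rack.MedTensor.tmul x y ◃ Rack.MedTensor.tmul x' y :=
  congrArg (Rack.Quo.mk _) (Rack.Quo.sound (Rack.TensorRel.act_left x' x y)).symm

theorem Rack.MedTensor.tmul_act {X Y : Type u} [Rack X] [Rack Y] (x : X) (y y' : Y) :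
    Rack.MedTensor.tmul x (y ◃ y') = Rack.MedTensor.tmul x y ◃ Rack.MedTensor.tmul x y' :=
  congrArg (Rack.Quo.mk _) (Rack.Quo.sound (Rack.TensorRel.act_right x y' y)).symm

/-- The homomorphism from the medial tensor product induced by a family of homomorphisms. -/
def Rack.MedTensor.lift {X Y M : Type u} [Rack X] [Rack Y] [Rack M] (hM : Rack.IsAbelian M)
    (l : Y → X →◃ M) (r : X → Y →◃ M) (h : ∀ x y, l y x = r x y) : Rack.MedTensor X Y →◃ M :=
  Rack.Quo.lift (Rack.Quo.lift (FreeRack.lift fun p => r p.1 p.2) (by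
    rintro _ _ (⟨x, y₁, y₂⟩ | ⟨x, y₁, y₂⟩ | ⟨x₁, x₂, y⟩ | ⟨x₁, x₂, y⟩)
    · exact ((r x).map_act (x := y₂) (y := y₁)).symm
    · exact ((r x).map_invAct' y₂ y₁).symm
    -- Here the left factor varies, so the homomorphism `l y` is needed; it agrees with `r` by `h`.
    · change r x₂ y ◃ r x₁ y = r (x₂ ◃ x₁) y
      rw [← h, ← h, ← h, (l y).map_act]
    · change r x₂ y ◃⁻¹ r x₁ y = r (x₂ ◃⁻¹ x₁) y
      rw [← h, ← h, ← h, (l y).map_invAct'])) (by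
    rintro _ _ ⟨x, y, z, a⟩
    simp only [ShelfHom.map_act]
    -- Mediality of the target is what lets the map descend to the medialization.
    exact hM _ _ _ _)

theorem Rack.MedTensor.hom_ext {X Y M : Type u} [Rack X] [Rack Y] [Rack M]
    {f g : Rack.MedTensor X Y →◃ M}
    (h : ∀ x y, f (Rack.MedTensor.tmul x y) = g (Rack.MedTensor.tmul x y)) : f = g := by
  refine ShelfHom.ext (funext fun a => ?_)
  induction a using Quotient.inductionOn with
  | h b =>
    induction b using Quotient.inductionOn with
    | h c =>
      exact FreeRack.hom_ext (f := (f.comp (Rack.Quo.mkHom _)).comp (Rack.Quo.mkHom _))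
        (g := (g.comp (Rack.Quo.mkHom _)).comp (Rack.Quo.mkHom _))
        (fun p => h p.1 p.2) c

theorem MedRackCat.isHom_iff {A B : MedRackCat.{u}} (f : A.obj → B.obj) :
    IsHom (A := A) (B := B) f ↔ ∀ x y, f (x ◃ y) = f x ◃ f y := by
  constructor
  · rintro ⟨g, hg⟩ x y
    rw [← hg, ← hg, ← hg]
    exact g.hom.hom'.map_act
  · exact fun h => ⟨⟨⟨⟨f, fun {x y} => h x y⟩⟩⟩, fun _ => rfl⟩

theorem MedRackCat.hom_ext {A B : MedRackCat.{u}} {f g : A ⟶ B} (h : f.hom.hom' = g.hom.hom') :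
    f = g := ObjectProperty.hom_ext _ (RackCat.Hom.ext h)

/-- By mediality the pointwise product on the right is a homomorphism in `t`, an element of the Hom
rack. Both sides send the generator to `a ◃ b`, so freeness makes them equal. -/
theorem FreeRack.lift_act {A : Type u} [Rack A] (hA : Rack.IsAbelian A) (a b : A)
    (t : FreeRack PUnit.{u + 1}) : FreeRack.lift (fun _ => a ◃ b) t =
      FreeRack.lift (fun _ => a) t ◃ FreeRack.lift (fun _ => b) t :=
  letI := Rack.homRack (FreeRack PUnit.{u + 1}) hA
  FreeRack.hom_ext (f := FreeRack.lift fun _ => a ◃ b)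
    (g := FreeRack.lift (fun _ => a) ◃ FreeRack.lift (fun _ => b)) (fun _ => rfl) t

/-- The medial tensor product and the Hom rack of medial racks. -/
def MedRackCat.bihomTensor : BihomTensor MedRackCat.{u} where
  tensor := MedRackCat.tensor
  tmul {A B} a b := (Rack.MedTensor.tmul a b : Rack.MedTensor A.obj B.obj)
  isBihom_tmul _ _ :=
    ⟨fun _ => (isHom_iff _).2 fun _ _ => Rack.MedTensor.act_tmul _ _ _,
      fun _ => (isHom_iff _).2 fun _ _ => Rack.MedTensor.tmul_act _ _ _⟩
  exists_lift {A B D} f hf := by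
    choose l hl using hf.left
    choose r hr using hf.right
    exact ⟨⟨⟨Rack.MedTensor.lift D.property (fun b => (l b).hom.hom') (fun a => (r a).hom.hom')
      fun a b => (hl b a).trans (hr a b).symm⟩⟩, hr⟩
  hom_ext _ _ h := MedRackCat.hom_ext (Rack.MedTensor.hom_ext h)
  unit := MedRackCat.unit
  gen := (FreeRack.of PUnit.unit : FreeRack PUnit.{u + 1})
  unit_exists_bihom A := ⟨fun t a => FreeRack.lift (R := A.obj) (fun _ => a) t,
    ⟨fun _ => (isHom_iff _).2 fun _ _ => ShelfHom.map_act _,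
      fun t => (isHom_iff _).2 fun a b => FreeRack.lift_act A.property a b t⟩, fun _ => rfl⟩
  unit_hom_ext _ _ h := MedRackCat.hom_ext (ShelfHom.ext (funext (FreeRack.hom_ext fun _ => h)))
  hom := MedRackCat.homObj
  homEquiv :=
    { toFun f := ⟨⟨f⟩⟩
      invFun f := f.hom.hom'
      left_inv _ := rfl
      right_inv _ := rfl }
  isHom_eval _ := (isHom_iff _).2 fun _ _ => rfl
  exists_curry {K A B} f hf := by
    choose r hr using hf.right
    refine ⟨⟨⟨⟨fun k => (r k).hom.hom', fun {x y} => ShelfHom.ext (funext fun a => ?_)⟩⟩⟩, hr⟩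
    -- The Hom rack is pointwise, so at `a` this is the homomorphism property of `f` in its first
    -- variable.
    exact (hr (x ◃ y) a).trans (((isHom_iff _).1 (hf.left a) x y).trans
      (congrArg₂ _ (hr x a).symm (hr y a).symm))

/-! ## Universal properties for GL-racks -/

theorem GLRackHom.map_act {X Y : Type u} [GLRack X] [GLRack Y] (f : GLRackHom X Y) (x y : X) :
    f (x ◃ y) = f x ◃ f y := f.map_act'

theorem GLRackHom.map_invAct {X Y : Type u} [GLRack X] [GLRack Y] (f : GLRackHom X Y) (x y : X) :
    f (x ◃⁻¹ y) = f x ◃⁻¹ f y := f.toShelfHom.map_invAct' x y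

theorem GLRackHom.map_u {X Y : Type u} [GLRack X] [GLRack Y] (f : GLRackHom X Y) (x : X) :
    f (GLRack.u x) = GLRack.u (f x) := f.map_u' x

/-- Hence kernels of GL-rack homomorphisms are congruences for `u⁻¹` too. -/
theorem GLRackHom.map_u_symm {X Y : Type u} [GLRack X] [GLRack Y] (f : GLRackHom X Y) (x : X) :
    f (GLRack.u.symm x) = GLRack.u.symm (f x) := by
  rw [Equiv.eq_symm_apply, ← f.map_u, Equiv.apply_symm_apply]

/-- The value of a term in a GL-rack. -/
def GLRackTerm.eval {X R : Type u} [GLRack R] (f : X → R) : GLRackTerm X → R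
  | .of x => f x
  | .act a b => eval f a ◃ eval f b
  | .invAct a b => eval f a ◃⁻¹ eval f b
  | .u a => GLRack.u (eval f a)
  | .uInv a => GLRack.u.symm (eval f a)

theorem GLRackTerm.eval_eq {X R : Type u} [GLRack R] (f : X → R) {a b : GLRackTerm X}
    (h : GLRackTerm.Rel X a b) : a.eval f = b.eval f := by
  induction h with
  | refl => rfl
  | symm _ ih => exact ih.symm
  | trans _ _ ih ih' => exact ih.trans ih'
  | act _ _ ih ih' => exact congrArg₂ (· ◃ ·) ih ih'
  | invAct _ _ ih ih' => exact congrArg₂ (· ◃⁻¹ ·) ih ih'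
  | u _ ih => exact congrArg (GLRack.u ·) ih
  | uInv _ ih => exact congrArg (GLRack.u.symm ·) ih
  | self_distrib => exact Shelf.self_distrib
  | left_inv => exact Rack.left_inv _ _
  | right_inv => exact Rack.right_inv _ _
  | u_left_inv => exact Equiv.symm_apply_apply _ _
  | u_right_inv => exact Equiv.apply_symm_apply _ _
  | u_map_act => exact GLRack.u_map_act _ _
  | u_act => exact GLRack.u_act _ _

/-- The homomorphism from the free GL-rack that extends a map on generators. -/
def FreeGLRack.lift {X R : Type u} [GLRack R] (f : X → R) : GLRackHom (FreeGLRack X) R where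
  toFun := Quotient.lift (GLRackTerm.eval f) fun _ _ h => GLRackTerm.eval_eq f h
  map_act' {x y} := by
    induction x, y using Quotient.inductionOn₂
    rfl
  map_u' x := by
    induction x using Quotient.inductionOn
    rfl

theorem FreeGLRack.hom_ext {X R : Type u} [GLRack R] {f g : GLRackHom (FreeGLRack X) R}
    (h : ∀ x, f (FreeGLRack.of x) = g (FreeGLRack.of x)) (a : FreeGLRack X) : f a = g a := by
  induction a using Quotient.inductionOn with
  | h t =>
    induction t with
    | of x => exact h x
    | act s t hs ht =>
      exact (f.map_act (Quotient.mk _ s) (Quotient.mk _ t)).trans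
        ((congrArg₂ _ hs ht).trans (g.map_act _ _).symm)
    | invAct s t hs ht =>
      exact (f.map_invAct (Quotient.mk _ s) (Quotient.mk _ t)).trans
        ((congrArg₂ _ hs ht).trans (g.map_invAct _ _).symm)
    | u s hs =>
      exact (f.map_u (Quotient.mk _ s)).trans ((congrArg _ hs).trans (g.map_u _).symm)
    | uInv s hs =>
      exact (f.map_u_symm (Quotient.mk _ s)).trans ((congrArg _ hs).trans (g.map_u_symm _).symm)

theorem GLRack.CongrGen.map_eq {R S : Type u} [GLRack R] [GLRack S] {r : R → R → Prop}
    (f : GLRackHom R S) (h : ∀ x y, r x y → f x = f y) {x y : R} (hxy : GLRack.CongrGen r x y) :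
    f x = f y := by
  induction hxy with
  | of hr => exact h _ _ hr
  | refl => rfl
  | symm _ ih => exact ih.symm
  | trans _ _ ih ih' => exact ih.trans ih'
  | act _ _ ih ih' => rw [f.map_act, f.map_act, ih, ih']
  | invAct _ _ ih ih' => rw [f.map_invAct, f.map_invAct, ih, ih']
  | u _ ih => rw [f.map_u, f.map_u, ih]
  | uInv _ ih => rw [f.map_u_symm, f.map_u_symm, ih]

/-- The homomorphism from the quotient of a GL-rack induced by a homomorphism that respects the
relation. -/
def GLRack.Quo.lift {R S : Type u} [GLRack R] [GLRack S] {r : R → R → Prop} (f : GLRackHom R S)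
    (h : ∀ x y, r x y → f x = f y) : GLRackHom (GLRack.Quo r) S where
  toFun := Quotient.lift f fun _ _ hxy => GLRack.CongrGen.map_eq f h hxy
  map_act' {x y} := by
    induction x, y using Quotient.inductionOn₂
    exact f.map_act _ _
  map_u' x := by
    induction x using Quotient.inductionOn
    exact f.map_u _

/-- The projection of a GL-rack onto its quotient, as a homomorphism. -/
def GLRack.Quo.mkHom {R : Type u} [GLRack R] (r : R → R → Prop) :
    GLRackHom R (GLRack.Quo r) where
  toFun := GLRack.Quo.mk r
  map_act' := rfl
  map_u' _ := rfl

theorem GLRack.Quo.sound {R : Type u} [GLRack R] {r : R → R → Prop} {x y : R} (h : r x y) :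
    GLRack.Quo.mk r x = GLRack.Quo.mk r y := Quotient.sound (GLRack.CongrGen.of h)

namespace GLRack.MedTensor

variable {X Y M : Type u} [GLRack X] [GLRack Y] [GLRack M]

theorem act_tmul (x x' : X) (y : Y) : tmul (x ◃ x') y = tmul x y ◃ tmul x' y :=
  congrArg (GLRack.Quo.mk _) (GLRack.Quo.sound (GLRack.TensorRel.act_left x' x y)).symm

theorem tmul_act (x : X) (y y' : Y) : tmul x (y ◃ y') = tmul x y ◃ tmul x y' :=
  congrArg (GLRack.Quo.mk _) (GLRack.Quo.sound (GLRack.TensorRel.act_right x y' y)).symm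

theorem u_tmul (x : X) (y : Y) : tmul (GLRack.u x) y = GLRack.u (tmul x y) :=
  congrArg (GLRack.Quo.mk _) (GLRack.Quo.sound (GLRack.TensorRel.u_left x y)).symm

theorem tmul_u (x : X) (y : Y) : tmul x (GLRack.u y) = GLRack.u (tmul x y) :=
  congrArg (GLRack.Quo.mk _) (GLRack.Quo.sound (GLRack.TensorRel.u_right x y)).symm

/-- The homomorphism from the medial tensor product induced by a family of homomorphisms. -/
def lift (hM : Rack.IsAbelian M) (l : Y → GLRackHom X M) (r : X → GLRackHom Y M)
    (h : ∀ x y, l y x = r x y) : GLRackHom (GLRack.MedTensor X Y) M :=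
  GLRack.Quo.lift (GLRack.Quo.lift (FreeGLRack.lift fun p => r p.1 p.2) (by
    rintro _ _ (⟨x, y₁, y₂⟩ | ⟨x, y₁, y₂⟩ | ⟨x₁, x₂, y⟩ | ⟨x₁, x₂, y⟩ | ⟨x, y⟩ | ⟨x, y⟩)
    · exact ((r x).map_act y₂ y₁).symm
    · exact ((r x).map_invAct y₂ y₁).symm
    · change r x₂ y ◃ r x₁ y = r (x₂ ◃ x₁) y
      rw [← h, ← h, ← h, (l y).map_act]
    · change r x₂ y ◃⁻¹ r x₁ y = r (x₂ ◃⁻¹ x₁) y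
      rw [← h, ← h, ← h, (l y).map_invAct]
    -- The two relations for `u` express compatibility in the left variable, through `l`, and in the
    -- right one, through `r`.
    · change GLRack.u (r x y) = r (GLRack.u x) y
      rw [← h, ← h, (l y).map_u]
    · exact ((r x).map_u y).symm)) (by
    rintro _ _ ⟨x, y, z, a⟩
    simp only [GLRackHom.map_act]
    exact hM _ _ _ _)

theorem hom_ext {f g : GLRackHom (GLRack.MedTensor X Y) M}
    (h : ∀ x y, f (tmul x y) = g (tmul x y)) : f = g := by
  refine GLRackHom.ext (funext fun a => ?_)
  induction a using Quotient.inductionOn with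
  | h b =>
    induction b using Quotient.inductionOn with
    | h c =>
      exact FreeGLRack.hom_ext (f := (f.comp (GLRack.Quo.mkHom _)).comp (GLRack.Quo.mkHom _))
        (g := (g.comp (GLRack.Quo.mkHom _)).comp (GLRack.Quo.mkHom _))
        (fun p => h p.1 p.2) c

end GLRack.MedTensor

theorem MedGLRackCat.isHom_iff {A B : MedGLRackCat.{u}} (f : A.obj → B.obj) :
    IsHom (A := A) (B := B) f ↔
      (∀ x y, f (x ◃ y) = f x ◃ f y) ∧ ∀ x, f (GLRack.u x) = GLRack.u (f x) := by
  constructor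
  · rintro ⟨g, hg⟩
    refine ⟨fun x y => ?_, fun x => ?_⟩
    · rw [← hg, ← hg, ← hg]
      exact g.hom.hom'.map_act x y
    · rw [← hg, ← hg]
      exact g.hom.hom'.map_u x
  · exact fun h => ⟨⟨⟨⟨⟨f, fun {x y} => h.1 x y⟩, h.2⟩⟩⟩, fun _ => rfl⟩

theorem MedGLRackCat.hom_ext {A B : MedGLRackCat.{u}} {f g : A ⟶ B}
    (h : f.hom.hom' = g.hom.hom') : f = g :=
  ObjectProperty.hom_ext _ (GLRackCat.Hom.ext h)

theorem FreeGLRack.lift_act {A : Type u} [GLRack A] (hA : Rack.IsAbelian A) (a b : A)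
    (t : FreeGLRack PUnit.{u + 1}) : FreeGLRack.lift (fun _ => a ◃ b) t =
      FreeGLRack.lift (fun _ => a) t ◃ FreeGLRack.lift (fun _ => b) t :=
  letI := GLRack.homGLRack (FreeGLRack PUnit.{u + 1}) hA
  FreeGLRack.hom_ext (f := FreeGLRack.lift fun _ => a ◃ b)
    (g := FreeGLRack.lift (fun _ => a) ◃ FreeGLRack.lift (fun _ => b)) (fun _ => rfl) t

/-- Postcomposition with `u` is the GL-structure of the Hom GL-rack, so both sides are homomorphisms
in `t`, with value `u a` at the generator. -/
theorem FreeGLRack.lift_u {A : Type u} [GLRack A] (hA : Rack.IsAbelian A) (a : A)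
    (t : FreeGLRack PUnit.{u + 1}) : FreeGLRack.lift (fun _ => GLRack.u a) t =
      GLRack.u (FreeGLRack.lift (fun _ => a) t) :=
  letI := GLRack.homGLRack (FreeGLRack PUnit.{u + 1}) hA
  FreeGLRack.hom_ext (f := FreeGLRack.lift fun _ => GLRack.u a)
    (g := GLRack.u (FreeGLRack.lift fun _ => a)) (fun _ => rfl) t

/-- The medial tensor product and the Hom GL-rack of medial GL-racks. -/
def MedGLRackCat.bihomTensor : BihomTensor MedGLRackCat.{u} where
  tensor := MedGLRackCat.tensor
  tmul {A B} a b := (GLRack.MedTensor.tmul a b : GLRack.MedTensor A.obj B.obj)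
  isBihom_tmul _ _ :=
    ⟨fun _ => (isHom_iff _).2
      ⟨fun _ _ => GLRack.MedTensor.act_tmul _ _ _, fun _ => GLRack.MedTensor.u_tmul _ _⟩,
      fun _ => (isHom_iff _).2
        ⟨fun _ _ => GLRack.MedTensor.tmul_act _ _ _, fun _ => GLRack.MedTensor.tmul_u _ _⟩⟩
  exists_lift {A B D} f hf := by
    choose l hl using hf.left
    choose r hr using hf.right
    exact ⟨⟨⟨GLRack.MedTensor.lift D.property (fun b => (l b).hom.hom') (fun a => (r a).hom.hom')
      fun a b => (hl b a).trans (hr a b).symm⟩⟩, hr⟩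
  hom_ext _ _ h := MedGLRackCat.hom_ext (GLRack.MedTensor.hom_ext h)
  unit := MedGLRackCat.unit
  gen := (FreeGLRack.of PUnit.unit : FreeGLRack PUnit.{u + 1})
  unit_exists_bihom A := ⟨fun t a => FreeGLRack.lift (R := A.obj) (fun _ => a) t,
    ⟨fun _ => (isHom_iff _).2 ⟨GLRackHom.map_act _, GLRackHom.map_u _⟩,
      fun t => (isHom_iff _).2 ⟨fun a b => FreeGLRack.lift_act A.property a b t,
        fun a => FreeGLRack.lift_u A.property a t⟩⟩, fun _ => rfl⟩
  unit_hom_ext _ _ h :=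
    MedGLRackCat.hom_ext (GLRackHom.ext (funext (FreeGLRack.hom_ext fun _ => h)))
  hom := MedGLRackCat.homObj
  homEquiv :=
    { toFun f := ⟨⟨f⟩⟩
      invFun f := f.hom.hom'
      left_inv _ := rfl
      right_inv _ := rfl }
  isHom_eval _ := (isHom_iff _).2 ⟨fun _ _ => rfl, fun _ => rfl⟩
  exists_curry {K A B} f hf := by
    choose r hr using hf.right
    refine ⟨⟨⟨⟨⟨fun k => (r k).hom.hom', fun {x y} => GLRackHom.ext (funext fun a => ?_)⟩,
      fun x => GLRackHom.ext (funext fun a => ?_)⟩⟩⟩, hr⟩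
    · exact (hr (x ◃ y) a).trans ((((isHom_iff _).1 (hf.left a)).1 x y).trans
        (congrArg₂ _ (hr x a).symm (hr y a).symm))
    · exact (hr (GLRack.u x) a).trans ((((isHom_iff _).1 (hf.left a)).2 x).trans
        (congrArg _ (hr x a).symm))

/-! ### The theorem -/

theorem mainTheorem7 :
    (∃ (_ : MonoidalCategory MedRackCat.{u}) (_ : SymmetricCategory MedRackCat.{u})
      (_ : MonoidalClosed MedRackCat.{u})
      (hT : ∀ A B : MedRackCat.{u}, A ⊗ B = MedRackCat.tensor A B)
      (hU : 𝟙_ MedRackCat.{u} = MedRackCat.unit)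
      (hH : ∀ A B : MedRackCat.{u}, (ihom A).obj B = MedRackCat.homObj A B),
      (∀ {A A' B B' : MedRackCat.{u}} (f : A ⟶ A') (g : B ⟶ B') (a : A.obj) (b : B.obj),
        (f ⊗ₘ g) (MedRackCat.tmul hT a b) = MedRackCat.tmul hT (f a) (g b)) ∧
      (∀ {A B C : MedRackCat.{u}} (a : A.obj) (b : B.obj) (c : C.obj),
        (α_ A B C).hom (MedRackCat.tmul hT (MedRackCat.tmul hT a b) c) =
          MedRackCat.tmul hT a (MedRackCat.tmul hT b c)) ∧
      (∀ {A : MedRackCat.{u}} (a : A.obj),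
        (λ_ A).hom (MedRackCat.tmul hT (eqToHom hU.symm
          (FreeRack.of PUnit.unit : MedRackCat.unit.{u}.obj)) a) = a) ∧
      (∀ {A : MedRackCat.{u}} (a : A.obj),
        (ρ_ A).hom (MedRackCat.tmul hT a (eqToHom hU.symm
          (FreeRack.of PUnit.unit : MedRackCat.unit.{u}.obj))) = a) ∧
      (∀ {A B : MedRackCat.{u}} (a : A.obj) (b : B.obj),
        (β_ A B).hom (MedRackCat.tmul hT a b) = MedRackCat.tmul hT b a) ∧
      (∀ {A B : MedRackCat.{u}} (a : A.obj) (f : A.obj →◃ B.obj),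
        (ihom.ev A).app B (MedRackCat.tmul hT a
          (eqToHom (hH A B).symm (f : (MedRackCat.homObj A B).obj))) = f a)) ∧
    (∃ (_ : MonoidalCategory MedGLRackCat.{u}) (_ : SymmetricCategory MedGLRackCat.{u})
      (_ : MonoidalClosed MedGLRackCat.{u})
      (hT : ∀ A B : MedGLRackCat.{u}, A ⊗ B = MedGLRackCat.tensor A B)
      (hU : 𝟙_ MedGLRackCat.{u} = MedGLRackCat.unit)
      (hH : ∀ A B : MedGLRackCat.{u}, (ihom A).obj B = MedGLRackCat.homObj A B),
      (∀ {A A' B B' : MedGLRackCat.{u}} (f : A ⟶ A') (g : B ⟶ B') (a : A.obj) (b : B.obj),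
        (f ⊗ₘ g) (MedGLRackCat.tmul hT a b) = MedGLRackCat.tmul hT (f a) (g b)) ∧
      (∀ {A B C : MedGLRackCat.{u}} (a : A.obj) (b : B.obj) (c : C.obj),
        (α_ A B C).hom (MedGLRackCat.tmul hT (MedGLRackCat.tmul hT a b) c) =
          MedGLRackCat.tmul hT a (MedGLRackCat.tmul hT b c)) ∧
      (∀ {A : MedGLRackCat.{u}} (a : A.obj),
        (λ_ A).hom (MedGLRackCat.tmul hT (eqToHom hU.symm
          (FreeGLRack.of PUnit.unit : MedGLRackCat.unit.{u}.obj)) a) = a) ∧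
      (∀ {A : MedGLRackCat.{u}} (a : A.obj),
        (ρ_ A).hom (MedGLRackCat.tmul hT a (eqToHom hU.symm
          (FreeGLRack.of PUnit.unit : MedGLRackCat.unit.{u}.obj))) = a) ∧
      (∀ {A B : MedGLRackCat.{u}} (a : A.obj) (b : B.obj),
        (β_ A B).hom (MedGLRackCat.tmul hT a b) = MedGLRackCat.tmul hT b a) ∧
      (∀ {A B : MedGLRackCat.{u}} (a : A.obj) (f : GLRackHom A.obj B.obj),
        (ihom.ev A).app B (MedGLRackCat.tmul hT a
          (eqToHom (hH A B).symm (f : (MedGLRackCat.homObj A B).obj))) = f a)) := by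
  constructor
  · let T := MedRackCat.bihomTensor.{u}
    -- The identifications of objects hold by `rfl`, so each `eqToHom` reduces to an identity and
    -- the formulas on pure tensors apply as they stand.
    exact ⟨T.monoidalCategory, T.symmetricCategory, T.monoidalClosed, fun _ _ => rfl, rfl,
      fun _ _ => rfl, T.map_tmul, T.assoc_hom_tmul, T.leftUnitor_hom_tmul,
      T.rightUnitor_hom_tmul, T.swap_tmul,
      -- Evaluation is the transpose of the identity of the internal hom.
      fun a f => T.tensorHomEquiv_symm_tmul (𝟙 _) a f⟩
  · let T := MedGLRackCat.bihomTensor.{u}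
    exact ⟨T.monoidalCategory, T.symmetricCategory, T.monoidalClosed, fun _ _ => rfl, rfl,
      fun _ _ => rfl, T.map_tmul, T.assoc_hom_tmul, T.leftUnitor_hom_tmul,
      T.rightUnitor_hom_tmul, T.swap_tmul,
      fun a f => T.tensorHomEquiv_symm_tmul (𝟙 _) a f⟩
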